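/- Let $N\ge1$ be an integer, let $q\in\mathbb C$ with $0<|q|<1$, and fix any logarithm $w$ of $q$ (so $e^{w}=q$); for rational $s$ put $q^{s}=e^{sw}$. Write $(q)_k=\prod_{i=1}^{k}(1-q^i)$ and $(q)_\infty=\prod_{i\ge1}(1-q^i)$. Let $C$ be the Cartan matrix of the Lie algebra $A_{N-1}$, i.e. the $(N-1)\times(N-1)$ matrix with entries $C_{ab}=2\delta_{a,b}-\delta_{a,b-1}-\delta_{a,b+1}$. Then $$\frac{1}{(q)_\infty}\sum_{j=-\infty}^{\infty}(-1)^j q^{((1+2/N)j+1)j/2}\sum_{\substack{\vec\eta\in\mathbb Z_{\ge0}^{N-1}\\ j/N-(C^{-1}\vec\eta)_1\in\mathbb Z}}\frac{q^{\vec\eta\,C^{-1}\vec\eta}}{(q)_{\eta_1}\cdots(q)_{\eta_{N-1}}}=1,$$ where the infinite product, the inner sum for every $j\in\mathbb Z$, and the outer sum over $j$ all converge absolutely. For $N=1$ there is only the empty vector $\vec\eta$, and $(C^{-1}\vec\eta)_1$ is read as $0$, so that the inner sum equals $1$. -/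

import Mathlib

open scoped Matrix

noncomputable section

namespace GenEuler

/-- The `q`-shifted factorial `(a)_k = (1 - a)(1 - aq) ⋯ (1 - aq^(k-1))` (base `q`). -/
def qPoch (a q : ℂ) (k : ℕ) : ℂ := ∏ i ∈ Finset.range k, (1 - a * q ^ i)

/-- The infinite `q`-shifted factorial `(a)_∞ = ∏_{i ≥ 0} (1 - aq^i)` (base `q`). -/
def qPochInf (a q : ℂ) : ℂ := ∏' i : ℕ, (1 - a * q ^ i)

/-- The Cartan matrix `C` of `A_{N-1}`, with rational entries. -/
def cartan (N : ℕ) : Matrix (Fin (N - 1)) (Fin (N - 1)) ℚ :=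
  (CartanMatrix.A (N - 1)).map (fun z : ℤ => (z : ℚ))

/-- The vector with entries `(e_l)_j = δ_{l,j}`, where `j = 1, …, N-1` (coordinate `j` is stored
at the index `j - 1` of `Fin (N - 1)`).  If `N = 1` it is the empty vector. -/
def unitVec (N l : ℕ) : Fin (N - 1) → ℚ := fun j => if (j : ℕ) + 1 = l then 1 else 0

/-- A vector of non-negative integers, with its entries viewed as rational numbers. -/
def ratVec {N : ℕ} (η : Fin (N - 1) → ℕ) : Fin (N - 1) → ℚ := fun j => (η j : ℚ)

/-- The first entry `(C⁻¹ η)_1 = e_1 C⁻¹ η`; the empty sum `0` if `N = 1`. -/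
def firstEntry {N : ℕ} (η : Fin (N - 1) → ℕ) : ℚ :=
  unitVec N 1 ⬝ᵥ ((cartan N)⁻¹ *ᵥ ratVec η)

/-- The quadratic form `η C⁻¹ η`. -/
def quadForm {N : ℕ} (η : Fin (N - 1) → ℕ) : ℚ :=
  ratVec η ⬝ᵥ ((cartan N)⁻¹ *ᵥ ratVec η)

/-- The summation range: all `η ∈ ℕ^(N-1)` with `j / N - (C⁻¹ η)_1 ∈ ℤ`. -/
def Admissible (N : ℕ) (j : ℤ) : Set (Fin (N - 1) → ℕ) :=
  {η | ∃ m : ℤ, (j : ℚ) / (N : ℚ) - firstEntry η = (m : ℚ)}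

/-- The power `q ^ s` with rational exponent, for the choice `w` of a logarithm of `q`. -/
def qPow (w : ℂ) (s : ℚ) : ℂ := Complex.exp ((s : ℂ) * w)

/-- The summand `q ^ (η C⁻¹ η) / ((q)_{η_1} ⋯ (q)_{η_{N-1}})`. -/
def innerTerm {N : ℕ} (q w : ℂ) (η : Fin (N - 1) → ℕ) : ℂ :=
  qPow w (quadForm η) / ∏ i, qPoch q q (η i)

/-- The summand `(-1) ^ j q ^ (((1 + 2/N) j + 1) j / 2) ∑_η …` of the sum over `j`. -/
def outerTerm (N : ℕ) (q w : ℂ) (j : ℤ) : ℂ :=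
  (-1 : ℂ) ^ j * qPow w (((1 + 2 / (N : ℚ)) * (j : ℚ) + 1) * (j : ℚ) / 2) *
    ∑' η : Admissible N j, innerTerm q w (η : Fin (N - 1) → ℕ)

end GenEuler

end

open Filter Topology

namespace GenEuler

/-! The identity is one Laurent coefficient, in an auxiliary variable `z` with `|z| = 1`, of a
character identity obtained by iterating a bilateral Bailey lemma.

Let `B_N(L) = ∑_j weylTerm N q z j · (z q^(1+L+j))_∞ / (q)_(L-j)`. A limiting `q`-Chu–Vandermonde
sum (`sum_qInv_mul_qPochInf`, `hasSum_bailey`) shows that summing `B_N(r)` against `z^r q^(r²) /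
(q)_(L-r)` gives `B_(N+1)(L)` (`hasSum_baileySum_succ`). At level 0 the sum telescopes and is
independent of `L` (`baileySum_zero_eq`). So `B_N(L)` is that constant times an `N`-fold sum over
chains `L ≥ v_0 ≥ v_1 ≥ ⋯` (`baileySum_zero_mul_chainSum`). As `L → ∞`, this becomes (chain sum) ×
(level 0 numerator) = `(q)_∞` × (level `N` numerator), which is `tsum_chainSum_mul_tsum_weylTerm`.

Now compare coefficients of `z^1` (`tsum_coeff_eq_of_laurent_eq`). The level `N` numerator
contributes the single term `-1`. In the level 0 numerator the coefficient of `z^m` is `(-1)^m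
q^(m(m-1)/2)`, so a chain with entry sum `s` is paired with exactly `m = 1 - s`. Hence the sum over
chains of `(-1)^s q^(s(s-1)/2 + ∑ v_i²) / ∏ (q)_(v_i - v_(i+1))` equals `(q)_∞` (`hasSum_chain`).

Finally, encode a chain by its top `r` and its differences `η`. Inverting the Cartan matrix gives
`(C⁻¹η)_1 = r - s/N` and `η C⁻¹ η = ∑ v_i² - s²/N`. With `j = -s` the congruence says precisely that
`r` is an integer, and the `s²/N` is absorbed by the exponent `j²/N` of the outer sum. -/

/-! ### Convergence and non-vanishing of `q`-factorials -/

theorem summable_norm_mul_pow {q : ℂ} (hq : ‖q‖ < 1) (x : ℂ) :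
    Summable fun i : ℕ => ‖-(x * q ^ i)‖ := by
  simp only [norm_neg, norm_mul, norm_pow]
  exact (summable_geometric_of_lt_one (norm_nonneg q) hq).mul_left _

theorem multipliable_one_sub_mul_pow {q : ℂ} (hq : ‖q‖ < 1) (x : ℂ) :
    Multipliable fun i : ℕ => 1 - x * q ^ i := by
  simpa only [sub_eq_add_neg] using
    multipliable_one_add_of_summable (summable_norm_mul_pow hq x)

theorem qPochInf_eq_mul {q : ℂ} (hq : ‖q‖ < 1) (x : ℂ) :
    qPochInf x q = (1 - x) * qPochInf (x * q) q := by
  have h := multipliable_one_sub_mul_pow hq (x * q)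
  have e : (fun i : ℕ => 1 - x * q * q ^ i) = fun i : ℕ => 1 - x * q ^ (i + 1) := by
    funext i; ring
  rw [e] at h
  have h2 := tprod_eq_zero_mul' (f := fun i : ℕ => 1 - x * q ^ i) h
  simp only [pow_zero, mul_one] at h2
  simp only [qPochInf, e]
  exact h2

theorem tendsto_qPoch {q : ℂ} (hq : ‖q‖ < 1) (x : ℂ) :
    Tendsto (qPoch x q) atTop (𝓝 (qPochInf x q)) :=
  (multipliable_one_sub_mul_pow hq x).hasProd.tendsto_prod_nat

theorem norm_qPochInf_sub_one_le {q : ℂ} (hq : ‖q‖ < 1) (x : ℂ) :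
    ‖qPochInf x q - 1‖ ≤ Real.exp (‖x‖ * (1 - ‖q‖)⁻¹) - 1 := by
  refine le_of_tendsto ((tendsto_qPoch hq x).sub_const 1).norm (Eventually.of_forall fun k => ?_)
  have h := Finset.norm_prod_one_add_sub_one_le (Finset.range k) (fun i => -(x * q ^ i))
  simp only [← sub_eq_add_neg] at h
  refine h.trans (sub_le_sub_right (Real.exp_le_exp.mpr ?_) 1)
  refine ((summable_norm_mul_pow hq x).sum_le_tsum _ fun _ _ => norm_nonneg _).trans_eq ?_
  simp only [norm_neg, norm_mul, norm_pow]
  rw [tsum_mul_left, tsum_geometric_of_lt_one (norm_nonneg q) hq]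

theorem one_sub_pow_succ_ne_zero {q : ℂ} (hq : ‖q‖ < 1) (k : ℕ) : 1 - q * q ^ k ≠ 0 := by
  intro h
  have h1 : ‖q * q ^ k‖ = 1 := by rw [← sub_eq_zero.mp h, norm_one]
  rw [← pow_succ', norm_pow] at h1
  exact (pow_lt_one₀ (norm_nonneg q) hq k.succ_ne_zero).ne h1

theorem qPoch_self_ne_zero {q : ℂ} (hq : ‖q‖ < 1) (k : ℕ) : qPoch q q k ≠ 0 :=
  Finset.prod_ne_zero_iff.mpr fun i _ => one_sub_pow_succ_ne_zero hq i

theorem qPochInf_self_ne_zero {q : ℂ} (hq : ‖q‖ < 1) : qPochInf q q ≠ 0 := by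
  have := tprod_one_add_ne_zero_of_summable (f := fun i : ℕ => -(q * q ^ i))
    (fun i => by simpa only [← sub_eq_add_neg] using one_sub_pow_succ_ne_zero hq i)
    (summable_norm_mul_pow hq q)
  simp only [← sub_eq_add_neg] at this
  exact this

/-! ### Reciprocal `q`-factorials at integer arguments -/

/-- The reciprocal `1 / (q)_n` for an integer `n`, read as `0` when `n` is negative. -/
noncomputable def qInv (q : ℂ) (n : ℤ) : ℂ := if n < 0 then 0 else (qPoch q q n.toNat)⁻¹

theorem qInv_of_neg (q : ℂ) {n : ℤ} (h : n < 0) : qInv q n = 0 := if_pos h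

theorem qInv_natCast (q : ℂ) (n : ℕ) : qInv q n = (qPoch q q n)⁻¹ := by
  simp [qInv]

theorem qInv_zero (q : ℂ) : qInv q 0 = 1 := by
  simp [qInv, qPoch]

/-- The convention `1 / (q)_n = 0` for `n < 0` makes this recurrence hold on all of `ℤ`: at `n = 0`
the factor `1 - q^0` supplies the zero. This lets sums run over `ℤ` without boundary terms. -/
theorem one_sub_mul_qInv {q : ℂ} (hq : ‖q‖ < 1) (n : ℤ) :
    (1 - q ^ n) * qInv q n = qInv q (n - 1) := by
  rcases lt_trichotomy n 0 with h | rfl | h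
  · rw [qInv_of_neg q h, qInv_of_neg q (by omega), mul_zero]
  · rw [qInv_of_neg q (by norm_num : (0 : ℤ) - 1 < 0)]; simp
  · obtain ⟨m, rfl⟩ : ∃ m : ℕ, n = (m : ℤ) + 1 := ⟨(n - 1).toNat, by omega⟩
    have h1 : qInv q ((m : ℤ) + 1) = (qPoch q q (m + 1))⁻¹ := by
      exact_mod_cast qInv_natCast q (m + 1)
    rw [add_sub_cancel_right, qInv_natCast, h1, qPoch, Finset.prod_range_succ, ← qPoch]
    have h2 := qPoch_self_ne_zero hq m
    have h3 := one_sub_pow_succ_ne_zero hq m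
    have h4 : q ^ ((m : ℤ) + 1) = q * q ^ m := by
      rw [← pow_succ']; exact_mod_cast zpow_natCast q (m + 1)
    rw [h4]
    field_simp

theorem tendsto_qInv_natCast {q : ℂ} (hq : ‖q‖ < 1) :
    Tendsto (fun n : ℕ => qInv q n) atTop (𝓝 (qPochInf q q)⁻¹) := by
  simp only [qInv_natCast]
  exact (tendsto_qPoch hq q).inv₀ (qPochInf_self_ne_zero hq)

theorem tendsto_qInv_sub {q : ℂ} (hq : ‖q‖ < 1) (j : ℤ) :
    Tendsto (fun L : ℕ => qInv q ((L : ℤ) - j)) atTop (𝓝 (qPochInf q q)⁻¹) := by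
  have h1 : Tendsto (fun L : ℕ => ((L : ℤ) - j).toNat) atTop atTop := by
    refine tendsto_atTop.mpr fun b => ?_
    filter_upwards [eventually_ge_atTop (b + j.natAbs)] with L hL
    omega
  refine ((tendsto_qInv_natCast hq).comp h1).congr' ?_
  filter_upwards [eventually_ge_atTop j.natAbs] with L hL
  simp only [Function.comp]
  congr 1
  omega

theorem exists_norm_qInv_le {q : ℂ} (hq : ‖q‖ < 1) : ∃ C : ℝ, 0 < C ∧ ∀ n, ‖qInv q n‖ ≤ C := by
  obtain ⟨C, hC⟩ := (tendsto_qInv_natCast hq).norm.bddAbove_range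
  refine ⟨max C 1, by positivity, fun n => ?_⟩
  rcases lt_or_ge n 0 with h | h
  · rw [qInv_of_neg q h, norm_zero]; positivity
  · obtain ⟨m, rfl⟩ := Int.eq_ofNat_of_zero_le h
    exact (hC ⟨m, rfl⟩).trans (le_max_left _ _)

/-! ### Gaussian majorants and growth of `(z q^m)_∞` on the unit circle -/

theorem summable_exp_neg_sq {a : ℝ} (ha : 0 < a) (b : ℝ) :
    Summable fun j : ℤ => Real.exp (-a * (j : ℝ) ^ 2 + b * |(j : ℝ)|) := by
  have h := summable_pow_mul_jacobiTheta₂_term_bound (b / (2 * Real.pi))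
    (div_pos ha Real.pi_pos) 0
  refine h.congr fun j => ?_
  rw [pow_zero, one_mul, Int.cast_abs]
  congr 1
  have := Real.pi_ne_zero
  field_simp
  ring

/-- With `t = -log |q|`, the norm estimates below reduce to comparing quadratic polynomials in
exponents. -/
theorem norm_zpow_eq_exp {q : ℂ} {t : ℝ} (ht : ‖q‖ = Real.exp (-t)) (n : ℤ) :
    ‖q ^ n‖ = Real.exp (-t * n) := by
  rw [norm_zpow, ht, ← Real.rpow_intCast, ← Real.exp_mul]

theorem norm_zpow_of_norm_one {z : ℂ} (hz : ‖z‖ = 1) (n : ℤ) : ‖z ^ n‖ = 1 := by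
  rw [norm_zpow, hz, one_zpow]

/-- A bound for `(z q ^ m)_∞` on the unit circle, uniform in `m ≥ c`. -/
theorem exists_norm_qPochInf_zpow_le {q : ℂ} {t : ℝ} (ht : ‖q‖ = Real.exp (-t)) (ht0 : 0 < t) :
    ∃ K : ℝ, ∀ z : ℂ, ‖z‖ = 1 → ∀ c m : ℤ, c ≤ m →
      ‖qPochInf (z * q ^ m) q‖ ≤ Real.exp (K + |(c : ℝ)| + t * (c * (c - 1)) / 2) := by
  have hq : ‖q‖ < 1 := by rw [ht]; simpa using ht0
  have hq0 : q ≠ 0 := norm_pos_iff.mp (by rw [ht]; positivity)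
  refine ⟨(1 - ‖q‖)⁻¹, fun z hz => ?_⟩
  set K := (1 - ‖q‖)⁻¹
  have key : ∀ n : ℕ, ∀ m : ℤ, -(n : ℤ) ≤ m →
      ‖qPochInf (z * q ^ m) q‖ ≤ Real.exp (K + n + t * (n * (n + 1)) / 2) := by
    intro n
    induction n with
    | zero =>
      intro m hm
      have hx : ‖z * q ^ m‖ ≤ 1 := by
        rw [norm_mul, hz, one_mul, norm_zpow_eq_exp ht, Real.exp_le_one_iff]
        have : (0 : ℝ) ≤ m := by exact_mod_cast (by omega : (0 : ℤ) ≤ m)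
        nlinarith
      have h1 := norm_qPochInf_sub_one_le hq (z * q ^ m)
      have h2 : Real.exp (‖z * q ^ m‖ * K) ≤ Real.exp K := by
        refine Real.exp_le_exp.mpr (mul_le_of_le_one_left ?_ hx)
        exact inv_nonneg.mpr (by linarith)
      have h3 := norm_le_norm_sub_add (qPochInf (z * q ^ m) q) 1
      rw [norm_one] at h3
      simp only [Nat.cast_zero, add_zero, zero_mul, mul_zero, zero_div]
      linarith
    | succ n ih =>
      intro m hm
      -- Only `m = -(n+1)` is new. Peeling off the factor `1 - z q^m` costs at most `1 + e^(t(n+1))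
      -- ≤ e^(1 + t(n+1))`, which is exactly the increment of the claimed exponent.
      rcases eq_or_lt_of_le hm with h | h
      · rw [qPochInf_eq_mul hq, mul_assoc, ← zpow_add_one₀ hq0, norm_mul]
        have h1 := ih (m + 1) (by push_cast at h; omega)
        have hn : (0 : ℝ) ≤ n := n.cast_nonneg
        have h2 : ‖1 - z * q ^ m‖ ≤ Real.exp (1 + t * (n + 1)) := by
          refine (norm_sub_le _ _).trans ?_
          rw [norm_mul, hz, one_mul, norm_one, norm_zpow_eq_exp ht, ← h, Real.exp_add]
          push_cast
          rw [show -t * -((n : ℝ) + 1) = t * (n + 1) by ring]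
          have h3 : 1 ≤ Real.exp (t * (n + 1)) := Real.one_le_exp (by positivity)
          have h4 := Real.add_one_le_exp (1 : ℝ)
          nlinarith
        refine (mul_le_mul h2 h1 (norm_nonneg _) (Real.exp_nonneg _)).trans_eq ?_
        rw [← Real.exp_add]
        congr 1
        push_cast
        ring
      · refine (ih m (by push_cast at h; omega)).trans (Real.exp_le_exp.mpr ?_)
        have hn : (0 : ℝ) ≤ n := n.cast_nonneg
        push_cast
        nlinarith
  intro c m hcm
  rcases le_or_gt 0 c with h | h
  · refine (key 0 m (by omega)).trans (Real.exp_le_exp.mpr ?_)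
    have h1 : (0 : ℝ) ≤ c * (c - 1) := by
      have : (0 : ℤ) ≤ c * (c - 1) := by
        rcases h.eq_or_lt with rfl | h'
        · simp
        · exact mul_nonneg h (by omega)
      exact_mod_cast this
    have h2 := abs_nonneg (c : ℝ)
    have h3 := mul_nonneg ht0.le h1
    simp only [Nat.cast_zero, add_zero, zero_mul, mul_zero, zero_div]
    linarith
  · obtain ⟨n, hn⟩ : ∃ n : ℕ, c = -(n : ℤ) := ⟨(-c).toNat, by omega⟩
    refine (key n m (by omega)).trans_eq ?_
    rw [hn]
    push_cast
    rw [abs_neg, Nat.abs_cast]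
    congr 1
    ring

theorem tendsto_qPochInf_zpow {q : ℂ} (hq : ‖q‖ < 1) (hq0 : q ≠ 0) (z : ℂ) (j : ℤ) :
    Tendsto (fun L : ℕ => qPochInf (z * q ^ (1 + (L : ℤ) + j)) q) atTop (𝓝 1) := by
  have h1 : Tendsto (fun L : ℕ => z * q ^ (1 + (L : ℤ) + j)) atTop (𝓝 0) := by
    have := (tendsto_pow_atTop_nhds_zero_of_norm_lt_one hq).const_mul (z * q ^ (1 + j))
    rw [mul_zero] at this
    refine this.congr fun L => ?_
    rw [show 1 + (L : ℤ) + j = (1 + j) + L by ring, zpow_add₀ hq0 (1 + j), zpow_natCast, mul_assoc]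
  refine tendsto_iff_norm_sub_tendsto_zero.mpr ?_
  refine squeeze_zero (fun _ => norm_nonneg _) (fun L => norm_qPochInf_sub_one_le hq _) ?_
  have h2 := ((h1.norm.mul_const (1 - ‖q‖)⁻¹).rexp).sub_const 1
  simpa using h2

theorem exp_mul_le_exp_mul_exp_mul {a b c C : ℝ} (hC : 0 ≤ C) (h : a ≤ b + c) :
    Real.exp a * C ≤ Real.exp b * (Real.exp c * C) := by
  rw [← mul_assoc, ← Real.exp_add]
  exact mul_le_mul_of_nonneg_right (Real.exp_le_exp.mpr h) hC

/-! ### The summation behind the Bailey lemma -/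

/-- A finite `q`-summation (the limiting case of `q`-Chu–Vandermonde behind Bailey's lemma). -/
theorem sum_qInv_mul_qPochInf {q : ℂ} (hq : ‖q‖ < 1) (hq0 : q ≠ 0) (n : ℕ) (y : ℂ) :
    ∑ k ∈ Finset.range (n + 1), y ^ k * q ^ (k ^ 2) * qInv q ((n : ℤ) - k) * qInv q k *
      qPochInf (y * q ^ (1 + k)) q = qInv q n * qPochInf (y * q ^ (1 + n)) q := by
  induction n generalizing y with
  | zero => simp [qInv_zero]
  | succ n ih =>
    -- After multiplication by `1 - q^(n+1) = (1 - q^(n+1-k)) + q^(n+1-k) (1 - q^k)`, each part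
    -- lowers one reciprocal factorial. The first is the case `n` at `y`; the second, after `k ↦ k +
    -- 1`, is the case `n` at `y q`. This is why `y` is generalised.
    have hne : (1 : ℂ) - q ^ (((n + 1 : ℕ)) : ℤ) ≠ 0 := by
      rw [zpow_natCast, pow_succ']; exact one_sub_pow_succ_ne_zero hq n
    apply mul_left_cancel₀ hne
    have h1 : ∑ k ∈ Finset.range (n + 1 + 1), y ^ k * q ^ (k ^ 2) *
        qInv q (((n + 1 : ℕ) : ℤ) - k - 1) * qInv q k * qPochInf (y * q ^ (1 + k)) q =
        qInv q n * qPochInf (y * q ^ (1 + n)) q := by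
      rw [Finset.sum_range_succ, qInv_of_neg q (by push_cast; omega : ((n + 1 : ℕ) : ℤ) -
        ((n + 1 : ℕ) : ℤ) - 1 < 0), mul_zero, zero_mul, zero_mul, add_zero, ← ih y]
      refine Finset.sum_congr rfl fun k _ => ?_
      rw [show ((n + 1 : ℕ) : ℤ) - (k : ℤ) - 1 = (n : ℤ) - k by push_cast; ring]
    have h2 : ∑ k ∈ Finset.range (n + 1 + 1), q ^ (((n + 1 : ℕ) : ℤ) - k) * (y ^ k * q ^ (k ^ 2)) *
        qInv q (((n + 1 : ℕ) : ℤ) - k) * qInv q ((k : ℤ) - 1) * qPochInf (y * q ^ (1 + k)) q =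
        y * q ^ (n + 1) * (qInv q n * qPochInf (y * q * q ^ (1 + n)) q) := by
      rw [Finset.sum_range_succ', qInv_of_neg q (by norm_num : ((0 : ℕ) : ℤ) - 1 < 0), mul_zero,
        zero_mul, add_zero, ← ih (y * q), Finset.mul_sum]
      refine Finset.sum_congr rfl fun k _ => ?_
      rw [show ((n + 1 : ℕ) : ℤ) - ((k + 1 : ℕ) : ℤ) = (n : ℤ) - k by push_cast; ring,
        show ((k + 1 : ℕ) : ℤ) - 1 = k by push_cast; ring,
        show y * q ^ (1 + (k + 1)) = y * q * q ^ (1 + k) by ring,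
        zpow_sub₀ hq0, zpow_natCast, zpow_natCast]
      have := pow_ne_zero k hq0
      field_simp
      ring
    rw [Finset.mul_sum]
    have h3 : ∀ k ∈ Finset.range (n + 1 + 1), (1 - q ^ (((n + 1 : ℕ)) : ℤ)) * (y ^ k * q ^ (k ^ 2) *
        qInv q (((n + 1 : ℕ) : ℤ) - k) * qInv q k * qPochInf (y * q ^ (1 + k)) q) =
        y ^ k * q ^ (k ^ 2) *
        qInv q (((n + 1 : ℕ) : ℤ) - k - 1) * qInv q k * qPochInf (y * q ^ (1 + k)) q +
        q ^ (((n + 1 : ℕ) : ℤ) - k) * (y ^ k * q ^ (k ^ 2)) *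
        qInv q (((n + 1 : ℕ) : ℤ) - k) * qInv q ((k : ℤ) - 1) * qPochInf (y * q ^ (1 + k)) q := by
      intro k _
      rw [← one_sub_mul_qInv hq (((n + 1 : ℕ) : ℤ) - k), ← one_sub_mul_qInv hq (k : ℤ),
        show q ^ (((n + 1 : ℕ)) : ℤ) = q ^ (((n + 1 : ℕ) : ℤ) - k) * q ^ (k : ℤ) by
          rw [← zpow_add₀ hq0]; congr 1; ring]
      ring
    rw [Finset.sum_congr rfl h3, Finset.sum_add_distrib, h1, h2, ← mul_assoc (1 - _),
      one_sub_mul_qInv hq, show ((n + 1 : ℕ) : ℤ) - 1 = n by push_cast; ring,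
      qPochInf_eq_mul hq (y * q ^ (1 + n)),
      show y * q ^ (1 + n) * q = y * q ^ (1 + (n + 1)) by ring,
      show y * q * q ^ (1 + n) = y * q ^ (1 + (n + 1)) by ring]
    ring

theorem hasSum_bailey {q : ℂ} (hq : ‖q‖ < 1) (hq0 : q ≠ 0) {z : ℂ} (hz : z ≠ 0) (L j : ℤ) :
    HasSum (fun r : ℤ => z ^ r * q ^ (r ^ 2) * qInv q (L - r) *
      (qPochInf (z * q ^ (1 + r + j)) q * qInv q (r - j)))
      (z ^ j * q ^ (j ^ 2) * (qPochInf (z * q ^ (1 + L + j)) q * qInv q (L - j))) := by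
  rcases lt_or_ge L j with h | h
  -- For `L < j` no `r` satisfies `j ≤ r ≤ L`, so every term vanishes.
  · rw [qInv_of_neg q (by omega : L - j < 0), mul_zero, mul_zero]
    convert hasSum_zero using 1
    funext r
    rcases lt_or_ge L r with h' | h'
    · rw [qInv_of_neg q (by omega : L - r < 0)]; simp
    · rw [qInv_of_neg q (by omega : r - j < 0)]; simp
  · obtain ⟨n, rfl⟩ : ∃ n : ℕ, L = j + n := ⟨(L - j).toNat, by omega⟩
    have hinj : Function.Injective fun k : ℕ => j + (k : ℤ) := fun a b hab => by
      simpa using hab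
    have hs := hasSum_sum_of_ne_finset_zero (L := SummationFilter.unconditional ℤ)
      (f := fun r : ℤ => z ^ r * q ^ (r ^ 2) * qInv q (j + n - r) *
        (qPochInf (z * q ^ (1 + r + j)) q * qInv q (r - j)))
      (s := (Finset.range (n + 1)).map ⟨_, hinj⟩) (by
        intro r hr
        rcases lt_or_ge (j + n) r with h' | h'
        · rw [qInv_of_neg q (by omega : j + n - r < 0)]; simp
        · rcases lt_or_ge r j with h'' | h''
          · rw [qInv_of_neg q (by omega : r - j < 0)]; simp
          · exfalso
            apply hr
            simp only [Finset.mem_map, Finset.mem_range, Function.Embedding.coeFn_mk]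
            exact ⟨(r - j).toNat, by omega, by omega⟩)
    convert hs using 1
    rw [Finset.sum_map]
    simp only [Function.Embedding.coeFn_mk]
    -- The substitution `r = j + k` turns `z^r q^(r²)` into `z^j q^(j²)` times `y^k q^(k²)` with `y
    -- = z q^(2j)`.
    have key := sum_qInv_mul_qPochInf hq hq0 n (z * q ^ (2 * j))
    rw [show j + (n : ℤ) - j = n by ring,
      show z * q ^ (1 + (j + (n : ℤ)) + j) = z * q ^ (2 * j) * q ^ (1 + n) by
        rw [mul_assoc, ← zpow_natCast q (1 + n), ← zpow_add₀ hq0]; congr 2; push_cast; ring,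
      mul_comm (qPochInf _ _), ← key, Finset.mul_sum]
    refine Finset.sum_congr rfl fun k _ => ?_
    rw [show j + (n : ℤ) - (j + k) = n - k by ring, show j + (k : ℤ) - j = k by ring,
      show z * q ^ (1 + (j + (k : ℤ)) + j) = z * q ^ (2 * j) * q ^ (1 + k) by
        rw [mul_assoc, ← zpow_natCast q (1 + k), ← zpow_add₀ hq0]; congr 2; push_cast; ring,
      show q ^ ((j + (k : ℤ)) ^ 2) = q ^ (j ^ 2) * (q ^ (2 * j)) ^ k * q ^ (k ^ 2) by
        rw [← zpow_natCast (q ^ (2 * j)), ← zpow_natCast q, ← zpow_mul, ← zpow_add₀ hq0,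
          ← zpow_add₀ hq0]
        congr 1; push_cast; ring,
      zpow_add₀ hz, zpow_natCast, mul_pow]
    ring

/-! ### Bilateral Bailey sums and raising the level -/

/-- The summand `z ^ ((N + 2) j) q ^ ((N + 2) j ^ 2 - j) (1 - z q ^ (2 j))` of the numerator of
the level `N` Weyl–Kac formula. -/
noncomputable def weylTerm (N : ℕ) (q z : ℂ) (j : ℤ) : ℂ :=
  z ^ (((N : ℤ) + 2) * j) * q ^ (((N : ℤ) + 2) * j ^ 2 - j) * (1 - z * q ^ (2 * j))

/-- The Bailey sum `∑_j weylTerm N q z j (z q ^ (1 + L + j))_∞ / (q)_{L - j}`. -/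
noncomputable def baileySum (N : ℕ) (q z : ℂ) (L : ℤ) : ℂ :=
  ∑' j : ℤ, weylTerm N q z j * (qPochInf (z * q ^ (1 + L + j)) q * qInv q (L - j))

theorem norm_weylTerm_le {q : ℂ} {t : ℝ} (ht : ‖q‖ = Real.exp (-t)) (ht0 : 0 < t) (N : ℕ) {z : ℂ}
    (hz : ‖z‖ = 1) (j : ℤ) :
    ‖weylTerm N q z j‖ ≤ Real.exp (-(t * 2) * (j : ℝ) ^ 2 + 3 * t * |(j : ℝ)| + 1) := by
  have h1 : ‖1 - z * q ^ (2 * j)‖ ≤ Real.exp (1 + 2 * t * |(j : ℝ)|) := by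
    refine (norm_sub_le _ _).trans ?_
    rw [norm_mul, hz, one_mul, norm_one, norm_zpow_eq_exp ht, Real.exp_add]
    have h2 : Real.exp (-t * ((2 * j : ℤ) : ℝ)) ≤ Real.exp (2 * t * |(j : ℝ)|) := by
      refine Real.exp_le_exp.mpr ?_
      push_cast
      nlinarith [neg_abs_le (j : ℝ)]
    have h3 : 1 ≤ Real.exp (2 * t * |(j : ℝ)|) := Real.one_le_exp (by positivity)
    have h4 := Real.add_one_le_exp (1 : ℝ)
    nlinarith
  rw [weylTerm, norm_mul, norm_mul, norm_zpow_of_norm_one hz, one_mul, norm_zpow_eq_exp ht]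
  refine (mul_le_mul_of_nonneg_left h1 (Real.exp_nonneg _)).trans ?_
  rw [← Real.exp_add]
  refine Real.exp_le_exp.mpr ?_
  push_cast
  have h5 : (0 : ℝ) ≤ N * (t * (j : ℝ) ^ 2) := by positivity
  nlinarith [le_abs_self (j : ℝ)]

theorem summable_of_norm_le_exp_neg_sq {f : ℤ → ℂ} {a : ℝ} (ha : 0 < a) (b c : ℝ)
    (h : ∀ j : ℤ, ‖f j‖ ≤ Real.exp (-a * (j : ℝ) ^ 2 + b * |(j : ℝ)|) * c) : Summable f :=
  ((summable_exp_neg_sq ha b).mul_right c).of_norm_bounded h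

/-- Summability of a Gaussian against `(z q ^ (a + j))_∞ / (q)_{b - j}`. -/
theorem summable_mul_qPochInf_mul_qInv {q : ℂ} {t : ℝ} (ht : ‖q‖ = Real.exp (-t)) (ht0 : 0 < t)
    {z : ℂ} (hz : ‖z‖ = 1) {f : ℤ → ℂ} {β γ : ℝ}
    (hf : ∀ j : ℤ, ‖f j‖ ≤ Real.exp (-(t * 2) * (j : ℝ) ^ 2 + β * |(j : ℝ)| + γ)) (a b : ℤ) :
    Summable fun j : ℤ => f j * (qPochInf (z * q ^ (a + j)) q * qInv q (b - j)) := by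
  have hq : ‖q‖ < 1 := by rw [ht]; simpa using ht0
  obtain ⟨K, hK⟩ := exists_norm_qPochInf_zpow_le ht ht0
  obtain ⟨C, hC0, hC⟩ := exists_norm_qInv_le hq
  refine summable_of_norm_le_exp_neg_sq ht0 (β + 1 + t * (|(a : ℝ)| + 1 / 2))
    (Real.exp (γ + K + |(a : ℝ)| + t * (a * (a - 1)) / 2) * C) fun j => ?_
  rw [norm_mul, norm_mul]
  refine (mul_le_mul (hf j) (mul_le_mul (hK z hz (a + j) (a + j) le_rfl) (hC _) (norm_nonneg _)
    (Real.exp_nonneg _)) (by positivity) (Real.exp_nonneg _)).trans ?_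
  rw [← mul_assoc, ← Real.exp_add]
  refine exp_mul_le_exp_mul_exp_mul hC0.le ?_
  push_cast
  have h1 := abs_add_le (a : ℝ) j
  have h2 : (a : ℝ) * j ≤ |(a : ℝ)| * |(j : ℝ)| := by rw [← abs_mul]; exact le_abs_self _
  have h3 : -|(j : ℝ)| ≤ j := neg_abs_le _
  have h4 := mul_le_mul_of_nonneg_left h2 ht0.le
  have h5 := mul_le_mul_of_nonneg_left h3 ht0.le
  have h6 : 0 ≤ t * (j : ℝ) ^ 2 := by positivity
  nlinarith

theorem summable_baileySum {q : ℂ} {t : ℝ} (ht : ‖q‖ = Real.exp (-t)) (ht0 : 0 < t) (N : ℕ) {z : ℂ}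
    (hz : ‖z‖ = 1) (L : ℤ) : Summable fun j : ℤ =>
      weylTerm N q z j * (qPochInf (z * q ^ (1 + L + j)) q * qInv q (L - j)) :=
  summable_mul_qPochInf_mul_qInv ht ht0 hz (fun j => norm_weylTerm_le ht ht0 N hz j) _ _

/-- Termwise, the difference of the two sums is `T j - T (j + 1)` for an explicit summable `T`, so
it telescopes over `ℤ` to zero. -/
theorem baileySum_zero_sub_one {q : ℂ} {t : ℝ} (ht : ‖q‖ = Real.exp (-t)) (ht0 : 0 < t) {z : ℂ}
    (hz : ‖z‖ = 1) (r : ℤ) : baileySum 0 q z r = baileySum 0 q z (r - 1) := by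
  have hq : ‖q‖ < 1 := by rw [ht]; simpa using ht0
  have hq0 : q ≠ 0 := norm_pos_iff.mp (by rw [ht]; positivity)
  have hz0 : z ≠ 0 := norm_pos_iff.mp (by rw [hz]; exact one_pos)
  set T : ℤ → ℂ := fun j => z ^ (2 * j) * q ^ (2 * j ^ 2 - j) * q ^ (r - j) *
    (qPochInf (z * q ^ (r + j)) q * qInv q (r - j)) with hT
  have hTs : Summable T := by
    refine summable_mul_qPochInf_mul_qInv ht ht0 hz (β := 2 * t) (γ := t * |(r : ℝ)|)
      (fun j => ?_) r r
    rw [norm_mul, norm_mul, norm_zpow_of_norm_one hz, one_mul, norm_zpow_eq_exp ht,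
      norm_zpow_eq_exp ht, ← Real.exp_add]
    refine Real.exp_le_exp.mpr ?_
    push_cast
    nlinarith [le_abs_self (j : ℝ), neg_abs_le (r : ℝ)]
  have hTs' : Summable fun j => T (j + 1) := (Equiv.addRight (1 : ℤ)).summable_iff.mpr hTs
  have hTeq : ∑' j, T (j + 1) = ∑' j, T j := (Equiv.addRight (1 : ℤ)).tsum_eq T
  rw [← sub_eq_zero, baileySum, baileySum,
    ← (summable_baileySum ht ht0 0 hz r).tsum_sub (summable_baileySum ht ht0 0 hz (r - 1)),
    ← sub_eq_zero.mpr hTeq.symm, ← hTs.tsum_sub hTs']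
  refine tsum_congr fun j => ?_
  simp only [hT, weylTerm]
  rw [show 1 + (r - 1) + j = r + j by ring, show r - 1 - j = r - j - 1 by ring,
    show r - (j + 1) = r - j - 1 by ring, ← one_sub_mul_qInv hq (r - j),
    show r + (j + 1) = 1 + r + j by ring, qPochInf_eq_mul hq (z * q ^ (r + j)),
    show z * q ^ (r + j) * q = z * q ^ (1 + r + j) by
      rw [mul_assoc, ← zpow_add_one₀ hq0]; congr 2; ring]
  generalize qPochInf (z * q ^ (1 + r + j)) q = E
  generalize qInv q (r - j) = A
  have e1 : q ^ (r + j) = q ^ (r - j) * (q ^ j) ^ 2 := by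
    rw [← zpow_natCast, ← zpow_mul, ← zpow_add₀ hq0]; congr 1; push_cast; ring
  have e2 : q ^ (2 * j) = (q ^ j) ^ 2 := by
    rw [← zpow_natCast, ← zpow_mul]; congr 1; push_cast; ring
  have e3 : q ^ (2 * (j + 1) ^ 2 - (j + 1)) * q ^ (r - j - 1) =
      q ^ (2 * j ^ 2 - j) * ((q ^ j) ^ 4 * q ^ (r - j)) := by
    rw [← zpow_natCast (q ^ j), ← zpow_mul, ← zpow_add₀ hq0, ← zpow_add₀ hq0, ← zpow_add₀ hq0]
    congr 1; push_cast; ring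
  have e4 : z ^ (2 * (j + 1)) = z ^ (2 * j) * z ^ 2 := by
    rw [mul_add, zpow_add₀ hz0]; norm_cast
  have e5 : z ^ (2 * (j + 1)) * q ^ (2 * (j + 1) ^ 2 - (j + 1)) * q ^ (r - j - 1) =
      z ^ (2 * j) * z ^ 2 * (q ^ (2 * j ^ 2 - j) * ((q ^ j) ^ 4 * q ^ (r - j))) := by
    rw [e4, mul_assoc, e3]
  rw [e5, e1, e2]
  simp only [Nat.cast_zero, zero_add]
  ring

theorem baileySum_zero_eq {q : ℂ} {t : ℝ} (ht : ‖q‖ = Real.exp (-t)) (ht0 : 0 < t) {z : ℂ}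
    (hz : ‖z‖ = 1) (r : ℤ) : baileySum 0 q z r = baileySum 0 q z 0 := by
  induction r using Int.induction_on with
  | zero => rfl
  | succ n ih => rw [baileySum_zero_sub_one ht ht0 hz, add_sub_cancel_right, ih]
  | pred n ih => rw [← baileySum_zero_sub_one ht ht0 hz, ih]

theorem summable_bailey_double {q : ℂ} {t : ℝ} (ht : ‖q‖ = Real.exp (-t)) (ht0 : 0 < t) (N : ℕ)
    {z : ℂ} (hz : ‖z‖ = 1) (L : ℤ) : Summable fun p : ℤ × ℤ =>
      weylTerm N q z p.1 * (z ^ p.2 * q ^ (p.2 ^ 2) * qInv q (L - p.2) *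
        (qPochInf (z * q ^ (1 + p.2 + p.1)) q * qInv q (p.2 - p.1))) := by
  have hq : ‖q‖ < 1 := by rw [ht]; simpa using ht0
  obtain ⟨K, hK⟩ := exists_norm_qPochInf_zpow_le ht ht0
  obtain ⟨C, hC0, hC⟩ := exists_norm_qInv_le hq
  -- The shear `r = j + k` separates the variables. The decay `2t j² + t (j+k)²` beats the growth `t
  -- (2j+k)² / 2` of the infinite product by `t j² + t k² / 2`, the cross terms cancelling; hence a
  -- product of two Gaussians dominates.
  let e : ℤ × ℤ ≃ ℤ × ℤ :=
    { toFun := fun p => (p.1, p.1 + p.2)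
      invFun := fun p => (p.1, p.2 - p.1)
      left_inv := fun p => by ext <;> simp
      right_inv := fun p => by ext <;> simp }
  rw [← e.summable_iff]
  have hg := ((summable_exp_neg_sq ht0 (4 * t + 2)).mul_of_nonneg
    (summable_exp_neg_sq (half_pos ht0) (t / 2 + 1)) (fun _ => Real.exp_nonneg _)
    (fun _ => Real.exp_nonneg _)).mul_right (Real.exp (K + 2) * C ^ 2)
  refine hg.of_norm_bounded fun p => ?_
  obtain ⟨j, k⟩ := p
  simp only [Function.comp, e, Equiv.coe_fn_mk]
  rw [norm_mul, norm_mul, norm_mul, norm_mul, norm_mul, norm_zpow_of_norm_one hz, one_mul,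
    norm_zpow_eq_exp ht]
  have h1 := norm_weylTerm_le ht ht0 N hz j
  have h2 := hK z hz (1 + (j + k) + j) _ le_rfl
  calc _ ≤ Real.exp (-(t * 2) * (j : ℝ) ^ 2 + 3 * t * |(j : ℝ)| + 1) *
      (Real.exp (-t * ((j + k) ^ 2 : ℤ)) * C * (Real.exp (K + |((1 + (j + k) + j : ℤ) : ℝ)| + t *
        (((1 + (j + k) + j : ℤ) : ℝ) * (((1 + (j + k) + j : ℤ) : ℝ) - 1)) / 2) * C)) := by
        gcongr
        · exact hC _
        · exact hC _
    _ = Real.exp ((-(t * 2) * (j : ℝ) ^ 2 + 3 * t * |(j : ℝ)| + 1) +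
      (-t * ((j + k) ^ 2 : ℤ)) + (K + |((1 + (j + k) + j : ℤ) : ℝ)| + t *
        (((1 + (j + k) + j : ℤ) : ℝ) * (((1 + (j + k) + j : ℤ) : ℝ) - 1)) / 2)) * C ^ 2 := by
        rw [Real.exp_add (_ + _) (K + _ + _), Real.exp_add (_ + _ + 1)]; ring
    _ ≤ _ := by
        rw [← Real.exp_add]
        refine exp_mul_le_exp_mul_exp_mul (by positivity) ?_
        push_cast
        have h3 : |1 + ((j : ℝ) + k) + j| ≤ 1 + 2 * |(j : ℝ)| + |(k : ℝ)| := by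
          have a1 := abs_add_le (1 + ((j : ℝ) + k)) j
          have a2 := abs_add_le 1 ((j : ℝ) + k)
          have a3 := abs_add_le (j : ℝ) k
          rw [abs_one] at a2
          linarith
        have h4 := mul_le_mul_of_nonneg_left (le_abs_self (j : ℝ)) ht0.le
        have h5 := mul_le_mul_of_nonneg_left (le_abs_self (k : ℝ)) ht0.le
        nlinarith

/-- The Bailey lemma, bilateral in form, raises the level by one. -/
theorem hasSum_baileySum_succ {q : ℂ} {t : ℝ} (ht : ‖q‖ = Real.exp (-t)) (ht0 : 0 < t) (N : ℕ)
    {z : ℂ} (hz : ‖z‖ = 1) (L : ℤ) :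
    HasSum (fun r : ℤ => z ^ r * q ^ (r ^ 2) * qInv q (L - r) * baileySum N q z r)
      (baileySum (N + 1) q z L) := by
  have hq : ‖q‖ < 1 := by rw [ht]; simpa using ht0
  have hq0 : q ≠ 0 := norm_pos_iff.mp (by rw [ht]; positivity)
  have hz0 : z ≠ 0 := norm_pos_iff.mp (by rw [hz]; exact one_pos)
  have hs := summable_bailey_double ht ht0 N hz L
  have h1 : HasSum _ _ := hs.hasSum
  have h2 : ∑' p : ℤ × ℤ, weylTerm N q z p.1 * (z ^ p.2 * q ^ (p.2 ^ 2) * qInv q (L - p.2) *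
        (qPochInf (z * q ^ (1 + p.2 + p.1)) q * qInv q (p.2 - p.1))) =
      baileySum (N + 1) q z L := by
    -- Summing over `r` first evaluates the inner sum by `hasSum_bailey`; its factor `z^j q^(j²)`
    -- raises the level of `weylTerm`. The other order of summation gives the left-hand side.
    rw [hs.tsum_prod, baileySum]
    refine tsum_congr fun j => ?_
    simp only
    rw [tsum_mul_left, (hasSum_bailey hq hq0 hz0 L j).tsum_eq, ← mul_assoc]
    congr 1
    simp only [weylTerm]
    rw [show ((N + 1 : ℕ) : ℤ) = (N : ℤ) + 1 by push_cast; ring,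
      show ((N : ℤ) + 1 + 2) * j = (N + 2) * j + j by ring,
      show ((N : ℤ) + 1 + 2) * j ^ 2 - j = ((N + 2) * j ^ 2 - j) + j ^ 2 by ring,
      zpow_add₀ hz0, zpow_add₀ hq0]
    ring
  rw [h2] at h1
  have h3 := ((Equiv.prodComm ℤ ℤ).hasSum_iff.mpr h1)
  have h4 := h3.prod_fiberwise fun r => (((Equiv.prodComm ℤ ℤ).summable_iff.mpr hs).prod_factor r).hasSum
  convert h4 using 2 with r
  rw [baileySum, ← tsum_mul_left]
  refine tsum_congr fun j => ?_
  simp only [Function.comp, Equiv.prodComm_apply, Prod.fst_swap, Prod.snd_swap]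
  ring

/-- Dominated convergence: `(z q^(1+L+j))_∞ → 1` and `1 / (q)_(L-j) → 1 / (q)_∞`. The growth bound
at `c = 1 + j ≤ 1 + L + j` is uniform in `L`. -/
theorem tendsto_baileySum {q : ℂ} {t : ℝ} (ht : ‖q‖ = Real.exp (-t)) (ht0 : 0 < t) (N : ℕ)
    {z : ℂ} (hz : ‖z‖ = 1) : Tendsto (fun L : ℕ => baileySum N q z L) atTop
      (𝓝 ((∑' j, weylTerm N q z j) * (qPochInf q q)⁻¹)) := by
  have hq : ‖q‖ < 1 := by rw [ht]; simpa using ht0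
  have hq0 : q ≠ 0 := norm_pos_iff.mp (by rw [ht]; positivity)
  obtain ⟨K, hK⟩ := exists_norm_qPochInf_zpow_le ht ht0
  obtain ⟨C, hC0, hC⟩ := exists_norm_qInv_le hq
  rw [← tsum_mul_right]
  refine tendsto_tsum_of_dominated_convergence
    (bound := fun j : ℤ => Real.exp (-t * (j : ℝ) ^ 2 + (4 * t + 1) * |(j : ℝ)|) *
      (Real.exp (K + 2) * C)) ((summable_exp_neg_sq ht0 _).mul_right _) (fun j => ?_) ?_
  · have := ((tendsto_qPochInf_zpow hq hq0 z j).mul (tendsto_qInv_sub hq j)).const_mul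
      (weylTerm N q z j)
    rwa [one_mul] at this
  · refine Eventually.of_forall fun L j => ?_
    rw [norm_mul, norm_mul]
    refine (mul_le_mul (norm_weylTerm_le ht ht0 N hz j) (mul_le_mul
      (hK z hz (1 + j) _ (by omega)) (hC _) (norm_nonneg _)
      (Real.exp_nonneg _)) (by positivity) (Real.exp_nonneg _)).trans ?_
    rw [← mul_assoc, ← Real.exp_add]
    refine exp_mul_le_exp_mul_exp_mul hC0.le ?_
    push_cast
    have h1 := abs_add_le (1 : ℝ) j
    rw [abs_one] at h1
    have h4 := mul_le_mul_of_nonneg_left (le_abs_self (j : ℝ)) ht0.le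
    have h6 : 0 ≤ t * (j : ℝ) ^ 2 := by positivity
    have h7 : 0 ≤ t * |(j : ℝ)| := by positivity
    nlinarith

/-! ### Chain sums and the character identity -/

/-- The weight of a chain `L ≥ v_0 ≥ v_1 ≥ ⋯`; it vanishes unless the chain is decreasing. -/
noncomputable def chainTerm {n : ℕ} (q : ℂ) (L : ℤ) (v : Fin n → ℤ) : ℂ :=
  ∏ i, q ^ (v i ^ 2) * qInv q ((Fin.cons L v : Fin (n + 1) → ℤ) i.castSucc - v i)

theorem chainTerm_cons {n : ℕ} (q : ℂ) (L r : ℤ) (v : Fin n → ℤ) :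
    chainTerm q L (Fin.cons r v : Fin (n + 1) → ℤ) =
      q ^ (r ^ 2) * qInv q (L - r) * chainTerm q r v := by
  rw [chainTerm, Fin.prod_univ_succ, chainTerm]
  simp only [Fin.castSucc_zero, Fin.cons_zero, Fin.castSucc_succ, Fin.cons_succ]

/-- Since `1 / (q)_n` is bounded, each entry of the chain contributes an independent Gaussian.
Uniformity in `L` is what the induction and the later limits need. -/
theorem exists_summable_norm_chainTerm_le {q : ℂ} {t : ℝ} (ht : ‖q‖ = Real.exp (-t)) (ht0 : 0 < t)
    (n : ℕ) : ∃ g : (Fin n → ℤ) → ℝ, Summable g ∧ ∀ L v, ‖chainTerm q L v‖ ≤ g v := by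
  have hq : ‖q‖ < 1 := by rw [ht]; simpa using ht0
  obtain ⟨C, hC0, hC⟩ := exists_norm_qInv_le hq
  induction n with
  | zero => exact ⟨fun _ => 1, .of_finite, fun L v => by simp [chainTerm]⟩
  | succ n ih =>
    obtain ⟨g, hg, hgb⟩ := ih
    have hg0 : ∀ v, 0 ≤ g v := fun v => (norm_nonneg _).trans (hgb 0 v)
    have hs := ((summable_exp_neg_sq ht0 0).mul_right C).mul_of_nonneg hg
      (fun _ => by positivity) hg0
    refine ⟨_, (Fin.consEquiv fun _ : Fin (n + 1) => ℤ).symm.summable_iff.mpr hs, fun L v => ?_⟩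
    obtain ⟨r, v, rfl⟩ : ∃ r w, v = (Fin.cons r w : Fin (n + 1) → ℤ) :=
      ⟨v 0, Fin.tail v, (Fin.cons_self_tail v).symm⟩
    simp only [Function.comp, Fin.consEquiv_symm_apply, Fin.cons_zero, Fin.tail_cons]
    rw [chainTerm_cons, norm_mul, norm_mul, norm_zpow_eq_exp ht]
    have h1 := hgb r v
    have h2 := hC (L - r)
    push_cast
    rw [zero_mul, add_zero]
    gcongr

/-- The sum of `chainTerm q L v * z ^ (v_0 + ⋯ + v_{n-1})` over all chains of length `n`. -/
noncomputable def chainSum (n : ℕ) (q z : ℂ) (L : ℤ) : ℂ :=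
  ∑' v : Fin n → ℤ, chainTerm q L v * z ^ (∑ i, v i)

theorem summable_chainTerm_mul {q : ℂ} {t : ℝ} (ht : ‖q‖ = Real.exp (-t)) (ht0 : 0 < t)
    (n : ℕ) {z : ℂ} (hz : ‖z‖ = 1) (L : ℤ) :
    Summable fun v : Fin n → ℤ => chainTerm q L v * z ^ (∑ i, v i) := by
  obtain ⟨g, hg, hgb⟩ := exists_summable_norm_chainTerm_le ht ht0 n
  refine hg.of_norm_bounded fun v => ?_
  rw [norm_mul, norm_zpow_of_norm_one hz, mul_one]
  exact hgb L v

theorem exists_norm_chainSum_le {q : ℂ} {t : ℝ} (ht : ‖q‖ = Real.exp (-t)) (ht0 : 0 < t)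
    (n : ℕ) {z : ℂ} (hz : ‖z‖ = 1) : ∃ C : ℝ, ∀ L, ‖chainSum n q z L‖ ≤ C := by
  obtain ⟨g, hg, hgb⟩ := exists_summable_norm_chainTerm_le ht ht0 n
  refine ⟨∑' v, g v, fun L => tsum_of_norm_bounded hg.hasSum fun v => ?_⟩
  rw [norm_mul, norm_zpow_of_norm_one hz, mul_one]
  exact hgb L v

theorem hasSum_chainSum_succ {q : ℂ} {t : ℝ} (ht : ‖q‖ = Real.exp (-t)) (ht0 : 0 < t)
    (n : ℕ) {z : ℂ} (hz : ‖z‖ = 1) (L : ℤ) :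
    HasSum (fun r : ℤ => z ^ r * q ^ (r ^ 2) * qInv q (L - r) * chainSum n q z r)
      (chainSum (n + 1) q z L) := by
  have hz0 : z ≠ 0 := norm_pos_iff.mp (by rw [hz]; exact one_pos)
  have h1 := (Fin.consEquiv fun _ : Fin (n + 1) => ℤ).hasSum_iff.mpr
    (summable_chainTerm_mul ht ht0 (n + 1) hz L).hasSum
  have e : ∀ r : ℤ, ∀ v : Fin n → ℤ,
      ((fun v : Fin (n + 1) → ℤ => chainTerm q L v * z ^ (∑ i, v i)) ∘
        (Fin.consEquiv fun _ : Fin (n + 1) => ℤ)) (r, v) =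
      z ^ r * q ^ (r ^ 2) * qInv q (L - r) * (chainTerm q r v * z ^ (∑ i, v i)) := by
    intro r v
    change chainTerm q L (Fin.cons r v : Fin (n + 1) → ℤ) *
      z ^ (∑ i, (Fin.cons r v : Fin (n + 1) → ℤ) i) = _
    rw [chainTerm_cons, Fin.sum_univ_succ, Fin.cons_zero, zpow_add₀ hz0]
    simp only [Fin.cons_succ]
    ring
  refine h1.prod_fiberwise fun r => ?_
  simp only [e]
  exact (summable_chainTerm_mul ht ht0 n hz r).hasSum.mul_left _

/-- Both sides satisfy the same recursion in `n`, and at `n = 0` the level 0 sum does not depend on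
`L`. The product form avoids dividing by that sum, which vanishes at `z = 1`. -/
theorem baileySum_zero_mul_chainSum {q : ℂ} {t : ℝ} (ht : ‖q‖ = Real.exp (-t)) (ht0 : 0 < t)
    (n : ℕ) {z : ℂ} (hz : ‖z‖ = 1) (L : ℤ) :
    baileySum 0 q z 0 * chainSum n q z L = baileySum n q z L := by
  induction n generalizing L with
  | zero => simp [chainSum, chainTerm, baileySum_zero_eq ht ht0 hz L]
  | succ n ih =>
    rw [← (hasSum_baileySum_succ ht ht0 n hz L).tsum_eq,
      ← (hasSum_chainSum_succ ht ht0 n hz L).tsum_eq, ← tsum_mul_left]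
    refine tsum_congr fun r => ?_
    rw [← ih r]
    ring

/-- The character identity `∑ (chains) * ∏ (denominator) = ∑ (Weyl–Kac numerator)`. -/
theorem tsum_chainSum_mul_tsum_weylTerm {q : ℂ} {t : ℝ} (ht : ‖q‖ = Real.exp (-t)) (ht0 : 0 < t)
    (n : ℕ) {z : ℂ} (hz : ‖z‖ = 1) :
    (∑' r : ℤ, z ^ r * q ^ (r ^ 2) * chainSum n q z r) * ∑' j, weylTerm 0 q z j =
      qPochInf q q * ∑' j, weylTerm (n + 1) q z j := by
  have hq : ‖q‖ < 1 := by rw [ht]; simpa using ht0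
  obtain ⟨C, hC0, hC⟩ := exists_norm_qInv_le hq
  obtain ⟨G, hG⟩ := exists_norm_chainSum_le ht ht0 n hz
  have hG0 : 0 ≤ G := (norm_nonneg _).trans (hG 0)
  -- A sequence constant in `L` equals its limit.
  have h0 : baileySum 0 q z 0 = (∑' j, weylTerm 0 q z j) * (qPochInf q q)⁻¹ := by
    refine tendsto_nhds_unique ?_ (tendsto_baileySum ht ht0 0 hz)
    simp only [baileySum_zero_eq ht ht0 hz]
    exact tendsto_const_nhds
  have h1 : Tendsto (fun L : ℕ => chainSum (n + 1) q z L) atTop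
      (𝓝 ((∑' r : ℤ, z ^ r * q ^ (r ^ 2) * chainSum n q z r) * (qPochInf q q)⁻¹)) := by
    simp only [← fun L : ℕ => (hasSum_chainSum_succ ht ht0 n hz L).tsum_eq]
    rw [← tsum_mul_right]
    refine tendsto_tsum_of_dominated_convergence
      (bound := fun r : ℤ => Real.exp (-t * (r : ℝ) ^ 2 + 0 * |(r : ℝ)|) * (C * G))
      ((summable_exp_neg_sq ht0 _).mul_right _) (fun r => ?_) (Eventually.of_forall fun L r => ?_)
    · have := ((tendsto_qInv_sub hq r).const_mul (z ^ r * q ^ (r ^ 2))).mul_const (chainSum n q z r)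
      convert this using 2
      ring
    · rw [norm_mul, norm_mul, norm_mul, norm_zpow_of_norm_one hz, one_mul, norm_zpow_eq_exp ht,
        zero_mul, add_zero, ← mul_assoc]
      push_cast
      have h2 := hC (L - r)
      have h3 := hG r
      gcongr
  have h2 := tendsto_nhds_unique (tendsto_baileySum ht ht0 (n + 1) hz)
    ((h1.const_mul (baileySum 0 q z 0)).congr fun L =>
      baileySum_zero_mul_chainSum ht ht0 (n + 1) hz L)
  rw [h0] at h2
  have := qPochInf_self_ne_zero hq
  field_simp at h2
  linear_combination -h2

/-! ### Extracting a Laurent coefficient -/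

theorem integral_exp_zpow (m : ℤ) :
    ∫ θ in (0 : ℝ)..(2 * Real.pi), Complex.exp (θ * Complex.I) ^ m =
      if m = 0 then 2 * (Real.pi : ℂ) else 0 := by
  split_ifs with h
  · subst h; simp
  · have hc : (m : ℂ) * Complex.I ≠ 0 := mul_ne_zero (by exact_mod_cast h) Complex.I_ne_zero
    have e : ∀ θ : ℝ, Complex.exp (θ * Complex.I) ^ m = Complex.exp ((m : ℂ) * Complex.I * θ) := by
      intro θ
      rw [← Complex.exp_int_mul]; congr 1; ring
    simp only [e]
    rw [integral_exp_mul_complex hc]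
    have h2 : Complex.exp ((m : ℂ) * Complex.I * ((2 * Real.pi : ℝ) : ℂ)) = 1 := by
      rw [← Complex.exp_int_mul_two_pi_mul_I m]; congr 1; push_cast; ring
    rw [h2]; simp

theorem integral_tsum_mul_exp_zpow {ι : Type*} [Countable ι] {a : ι → ℂ}
    (ha : Summable fun i => ‖a i‖) (e : ι → ℤ) :
    ∫ θ in (0 : ℝ)..(2 * Real.pi), ∑' i, a i * Complex.exp (θ * Complex.I) ^ e i =
      (2 * Real.pi : ℂ) * ∑' i, if e i = 0 then a i else 0 := by
  have hcont : ∀ i, Continuous fun θ : ℝ => a i * Complex.exp (θ * Complex.I) ^ e i := fun i =>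
    continuous_const.mul (Continuous.zpow₀ (by fun_prop) _ fun θ => .inl (Complex.exp_ne_zero _))
  let F : ι → C(ℝ, ℂ) := fun i => ⟨_, hcont i⟩
  have hF : ∀ i (θ : ℝ), ‖F i θ‖ = ‖a i‖ := fun i θ => by
    simp only [F, ContinuousMap.coe_mk]
    rw [norm_mul, norm_zpow_of_norm_one (Complex.norm_exp_ofReal_mul_I θ), mul_one]
  have h := intervalIntegral.hasSum_intervalIntegral_of_summable_norm (a := 0)
    (b := 2 * Real.pi) (f := F) (ha.of_nonneg_of_le (fun _ => norm_nonneg _) fun i => by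
      rw [ContinuousMap.norm_le _ (norm_nonneg _)]
      intro x
      exact (hF i x).le)
  simp only [F, ContinuousMap.coe_mk] at h
  rw [← h.tsum_eq, ← tsum_mul_left]
  refine tsum_congr fun i => ?_
  rw [intervalIntegral.integral_const_mul, integral_exp_zpow]
  split_ifs <;> ring

/-- Uniqueness of the coefficients of absolutely convergent Laurent series on the unit circle. -/
theorem tsum_coeff_eq_of_laurent_eq {ι κ : Type*} [Countable ι] [Countable κ] {a : ι → ℂ}
    {b : κ → ℂ} (ha : Summable fun i => ‖a i‖) (hb : Summable fun k => ‖b k‖) (e : ι → ℤ)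
    (f : κ → ℤ) (h : ∀ z : ℂ, ‖z‖ = 1 → ∑' i, a i * z ^ e i = ∑' k, b k * z ^ f k) (m : ℤ) :
    (∑' i, if e i = m then a i else 0) = ∑' k, if f k = m then b k else 0 := by
  have h1 := integral_tsum_mul_exp_zpow ha fun i => e i - m
  have h2 := integral_tsum_mul_exp_zpow hb fun k => f k - m
  simp only [sub_eq_zero] at h1 h2
  have hpi : (2 * Real.pi : ℂ) ≠ 0 := by
    exact_mod_cast mul_ne_zero two_ne_zero Real.pi_ne_zero
  -- Both sides are the integral over the circle of the common function times `z^(-m)`.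
  apply mul_left_cancel₀ hpi
  rw [← h1, ← h2]
  congr 1
  funext θ
  have h3 := h _ (Complex.norm_exp_ofReal_mul_I θ)
  simp only [zpow_sub₀ (Complex.exp_ne_zero _), div_eq_mul_inv, ← mul_assoc]
  rw [tsum_mul_right, tsum_mul_right, h3]

/-- The Laurent coefficients of `weylTerm N q z j`. -/
noncomputable def weylCoeff (N : ℕ) (q : ℂ) (p : ℤ × Bool) : ℂ :=
  if p.2 then -q ^ (((N : ℤ) + 2) * p.1 ^ 2 + p.1) else q ^ (((N : ℤ) + 2) * p.1 ^ 2 - p.1)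

/-- The Laurent exponents of `weylTerm N q z j`. -/
def weylExponent (N : ℕ) (p : ℤ × Bool) : ℤ :=
  ((N : ℤ) + 2) * p.1 + if p.2 then 1 else 0

theorem summable_norm_weylCoeff {q : ℂ} {t : ℝ} (ht : ‖q‖ = Real.exp (-t)) (ht0 : 0 < t) (N : ℕ) :
    Summable fun p => ‖weylCoeff N q p‖ := by
  have h := (summable_exp_neg_sq (mul_pos ht0 two_pos) t).mul_of_nonneg
    (g := fun _ : Bool => (1 : ℝ)) .of_finite (fun _ => Real.exp_nonneg _) fun _ => zero_le_one
  refine h.of_nonneg_of_le (fun _ => norm_nonneg _) fun p => ?_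
  obtain ⟨j, b⟩ := p
  have h5 : (0 : ℝ) ≤ N * (t * (j : ℝ) ^ 2) := by positivity
  have h6 := mul_le_mul_of_nonneg_left (le_abs_self (j : ℝ)) ht0.le
  have h7 := mul_le_mul_of_nonneg_left (neg_abs_le (j : ℝ)) ht0.le
  simp only [weylCoeff, mul_one]
  split_ifs
  · rw [norm_neg, norm_zpow_eq_exp ht]
    refine Real.exp_le_exp.mpr ?_
    push_cast
    nlinarith
  · rw [norm_zpow_eq_exp ht]
    refine Real.exp_le_exp.mpr ?_
    push_cast
    nlinarith

theorem tsum_weylCoeff {q : ℂ} {t : ℝ} (ht : ‖q‖ = Real.exp (-t)) (ht0 : 0 < t) (N : ℕ) {z : ℂ}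
    (hz : ‖z‖ = 1) : ∑' p, weylCoeff N q p * z ^ weylExponent N p = ∑' j, weylTerm N q z j := by
  have hq0 : q ≠ 0 := norm_pos_iff.mp (by rw [ht]; positivity)
  have hz0 : z ≠ 0 := norm_pos_iff.mp (by rw [hz]; exact one_pos)
  have hs : Summable fun p => weylCoeff N q p * z ^ weylExponent N p := by
    refine (summable_norm_weylCoeff ht ht0 N).of_norm_bounded fun p => ?_
    rw [norm_mul, norm_zpow_of_norm_one hz, mul_one]
  rw [hs.tsum_prod]
  refine tsum_congr fun j => ?_
  rw [tsum_fintype, Fintype.sum_bool]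
  simp only [weylCoeff, weylExponent, weylTerm]
  rw [show ((N : ℤ) + 2) * j ^ 2 + j = (((N : ℤ) + 2) * j ^ 2 - j) + 2 * j by ring]
  simp only [if_true, Bool.false_eq_true, if_false, add_zero]
  rw [zpow_add₀ hq0 _ (2 * j), zpow_add₀ hz0 _ 1, zpow_one]
  ring

theorem summable_norm_chain {q : ℂ} {t : ℝ} (ht : ‖q‖ = Real.exp (-t)) (ht0 : 0 < t) (n : ℕ) :
    Summable fun p : ℤ × (Fin n → ℤ) => ‖q ^ (p.1 ^ 2) * chainTerm q p.1 p.2‖ := by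
  obtain ⟨g, hg, hgb⟩ := exists_summable_norm_chainTerm_le ht ht0 n
  have h := (summable_exp_neg_sq ht0 0).mul_of_nonneg hg (fun _ => Real.exp_nonneg _)
    fun v => (norm_nonneg _).trans (hgb 0 v)
  refine h.of_nonneg_of_le (fun _ => norm_nonneg _) fun p => ?_
  rw [norm_mul, norm_zpow_eq_exp ht, zero_mul, add_zero]
  push_cast
  have := hgb p.1 p.2
  gcongr

theorem tsum_chain {q : ℂ} {t : ℝ} (ht : ‖q‖ = Real.exp (-t)) (ht0 : 0 < t) (n : ℕ) {z : ℂ}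
    (hz : ‖z‖ = 1) :
    ∑' p : ℤ × (Fin n → ℤ), q ^ (p.1 ^ 2) * chainTerm q p.1 p.2 * z ^ (p.1 + ∑ i, p.2 i) =
      ∑' r : ℤ, z ^ r * q ^ (r ^ 2) * chainSum n q z r := by
  have hz0 : z ≠ 0 := norm_pos_iff.mp (by rw [hz]; exact one_pos)
  have hs : Summable fun p : ℤ × (Fin n → ℤ) =>
      q ^ (p.1 ^ 2) * chainTerm q p.1 p.2 * z ^ (p.1 + ∑ i, p.2 i) := by
    refine (summable_norm_chain ht ht0 n).of_norm_bounded fun p => ?_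
    rw [norm_mul, norm_zpow_of_norm_one hz, mul_one]
  rw [hs.tsum_prod]
  refine tsum_congr fun r => ?_
  rw [chainSum, ← tsum_mul_left]
  refine tsum_congr fun v => ?_
  rw [zpow_add₀ hz0]
  ring

/-- The chain form of the identity. -/
theorem hasSum_chain {q : ℂ} {t : ℝ} (ht : ‖q‖ = Real.exp (-t)) (ht0 : 0 < t) (n : ℕ) :
    HasSum (fun p : ℤ × (Fin n → ℤ) => (-1 : ℂ) ^ (p.1 + ∑ i, p.2 i) *
      q ^ ((p.1 + ∑ i, p.2 i) * (p.1 + ∑ i, p.2 i - 1) / 2) *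
      (q ^ (p.1 ^ 2) * chainTerm q p.1 p.2)) (qPochInf q q) := by
  set u : ℤ × (Fin n → ℤ) → ℂ := fun p => q ^ (p.1 ^ 2) * chainTerm q p.1 p.2 with hu
  set e : ℤ × (Fin n → ℤ) → ℤ := fun p => p.1 + ∑ i, p.2 i with he
  have hsu : Summable fun p => ‖u p‖ := summable_norm_chain ht ht0 n
  have hsw := summable_norm_weylCoeff ht ht0
  have hprod : Summable fun x : (ℤ × (Fin n → ℤ)) × (ℤ × Bool) => ‖u x.1 * weylCoeff 0 q x.2‖ :=
    hsu.mul_norm (hsw 0)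
  have hcoeff := tsum_coeff_eq_of_laurent_eq hprod
    ((hsw (n + 1)).mul_left ‖qPochInf q q‖ |>.congr fun p => (norm_mul _ _).symm)
    (fun x => e x.1 + weylExponent 0 x.2) (weylExponent (n + 1)) (fun z hz => by
      have hz0 : z ≠ 0 := norm_pos_iff.mp (by rw [hz]; exact one_pos)
      have h := tsum_chainSum_mul_tsum_weylTerm ht ht0 n hz
      rw [← tsum_weylCoeff ht ht0 0 hz, ← tsum_weylCoeff ht ht0 (n + 1) hz, ← tsum_chain ht ht0 n hz] at h
      simp only [mul_assoc (qPochInf q q)]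
      rw [tsum_mul_left, ← h, tsum_mul_tsum_of_summable_norm]
      · refine tsum_congr fun x => ?_
        rw [zpow_add₀ hz0]
        simp only [hu, he]
        ring
      · refine hsu.congr fun p => ?_
        rw [norm_mul _ (z ^ _), norm_zpow_of_norm_one hz, mul_one]
      · refine (hsw 0).congr fun p => ?_
        rw [norm_mul, norm_zpow_of_norm_one hz, mul_one]) 1
  -- The exponents are `0` or `1` modulo `n + 3 ≥ 3`, so `z^1` occurs only at `j = 0`, in the second
  -- half of the Weyl term.
  have hR : (∑' k, if weylExponent (n + 1) k = 1 then qPochInf q q * weylCoeff (n + 1) q k else 0) =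
      -qPochInf q q := by
    rw [tsum_eq_single (0, true)]
    · simp [weylExponent, weylCoeff]
    · rintro ⟨j, b⟩ hne
      refine if_neg fun h => hne ?_
      simp only [weylExponent] at h
      cases b
      · exfalso
        simp only [Bool.false_eq_true, if_false, add_zero] at h
        have h1 : ((n + 1 : ℕ) : ℤ) + 2 ∣ 1 := ⟨j, h.symm⟩
        have h2 := Int.le_of_dvd one_pos h1
        push_cast at h2
        omega
      · simp only [if_true, add_eq_right] at h
        rcases mul_eq_zero.mp h with h1 | h1
        · push_cast at h1; omega
        · rw [h1]
  rw [hR] at hcoeff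
  have hsum : Summable fun x : (ℤ × (Fin n → ℤ)) × (ℤ × Bool) =>
      if e x.1 + weylExponent 0 x.2 = 1 then u x.1 * weylCoeff 0 q x.2 else 0 := by
    refine hprod.of_norm_bounded fun x => ?_
    split_ifs
    · exact le_rfl
    · rw [norm_zero]; exact norm_nonneg _
  have hS := hsum.hasSum
  rw [hcoeff] at hS
  have hfin := (hS.prod_fiberwise (g := fun p => -((-1 : ℂ) ^ e p * q ^ (e p * (e p - 1) / 2) * u p))
    fun p => ?_).neg
  · simpa only [neg_neg] using hfin
  · simp only
    -- The level 0 exponents `2j` and `2j + 1` exhaust `ℤ` without repetition, so the parity of `1 -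
    -- e p` selects the unique index contributing to this chain.
    rcases Int.even_or_odd (1 - e p) with ⟨j, hj⟩ | ⟨j, hj⟩
    · have hs : e p = 1 - 2 * j := by omega
      have h1 : (-1 : ℂ) ^ e p = -1 := by
        rw [hs]; exact Odd.neg_one_zpow ⟨-j, by ring⟩
      have h2 : e p * (e p - 1) / 2 = 2 * j ^ 2 - j := by
        rw [hs, show (1 - 2 * j) * (1 - 2 * j - 1) = 2 * (2 * j ^ 2 - j) by ring]
        exact Int.mul_ediv_cancel_left _ two_ne_zero
      convert hasSum_single (L := SummationFilter.unconditional _) (j, false) ?_ using 1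
      · rw [if_pos (by simp [weylExponent]; omega), h1, h2]
        simp [weylCoeff, mul_comm]
      · rintro ⟨k, b⟩ hne
        refine if_neg fun h => hne ?_
        simp only [weylExponent, Nat.cast_zero, zero_add] at h
        cases b
        · simp only [Bool.false_eq_true, if_false, add_zero] at h
          rw [show k = j by omega]
        · simp only [if_true] at h
          omega
    · have hs : e p = -2 * j := by omega
      have h1 : (-1 : ℂ) ^ e p = 1 := by
        rw [hs]; exact Even.neg_one_zpow ⟨-j, by ring⟩
      have h2 : e p * (e p - 1) / 2 = 2 * j ^ 2 + j := by
        rw [hs, show (-2 * j) * (-2 * j - 1) = 2 * (2 * j ^ 2 + j) by ring]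
        exact Int.mul_ediv_cancel_left _ two_ne_zero
      convert hasSum_single (L := SummationFilter.unconditional _) (j, true) ?_ using 1
      · rw [if_pos (by simp [weylExponent]; omega), h1, h2]
        simp [weylCoeff, mul_comm]
      · rintro ⟨k, b⟩ hne
        refine if_neg fun h => hne ?_
        simp only [weylExponent, Nat.cast_zero, zero_add] at h
        cases b
        · simp only [Bool.false_eq_true, if_false, add_zero] at h
          omega
        · simp only [if_true] at h
          rw [show k = j by omega]

/-! ### Inverting the Cartan matrix -/

/-- The deviation `a_0 + ⋯ + a_{k-1} - k (a_0 + ⋯ + a_n) / (n + 1)` of a partial sum. -/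
def centredSum (n : ℕ) (a : ℕ → ℚ) (k : ℕ) : ℚ :=
  ∑ i ∈ Finset.range k, a i - k * ((∑ i ∈ Finset.range (n + 1), a i) / (n + 1))

theorem centredSum_succ (n : ℕ) (a : ℕ → ℚ) (k : ℕ) :
    centredSum n a (k + 1) =
      centredSum n a k + (a k - (∑ i ∈ Finset.range (n + 1), a i) / (n + 1)) := by
  rw [centredSum, centredSum, Finset.sum_range_succ a k]
  push_cast
  ring

theorem centredSum_zero (n : ℕ) (a : ℕ → ℚ) : centredSum n a 0 = 0 := by
  simp [centredSum]

theorem centredSum_last (n : ℕ) (a : ℕ → ℚ) : centredSum n a (n + 1) = 0 := by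
  rw [centredSum]
  have : (n : ℚ) + 1 ≠ 0 := by positivity
  push_cast
  field_simp
  ring

/-- `C` is the negative discrete Laplacian; the boundary values `0` let the first and last rows take
the same form as the others. -/
theorem cartan_mulVec {n : ℕ} (X : ℕ → ℚ) (h0 : X 0 = 0) (hn : X (n + 1) = 0) :
    cartan (n + 1) *ᵥ (fun l : Fin n => X (l + 1)) =
      fun l : Fin n => 2 * X (l + 1) - X l - X (l + 2) := by
  funext l
  have hl : (l : ℕ) < n := l.isLt
  change ∑ m : Fin n, cartan (n + 1) l m * X (m + 1) = _
  have e : ∀ m : Fin n, cartan (n + 1) l m * X (m + 1) =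
      (if (m : ℕ) = l then 2 * X (m + 1) else 0) - (if (m : ℕ) = l + 1 then X (m + 1) else 0) -
        (if (m : ℕ) + 1 = l then X (m + 1) else 0) := by
    intro m
    change (((if l = m then (2 : ℤ) else if l.val + 1 = m.val ∨ m.val + 1 = l.val then -1 else 0 :
      ℤ)) : ℚ) * _ = _
    rcases eq_or_ne l m with rfl | hne
    · simp
    · have hne' : (m : ℕ) ≠ l := fun h => hne (Fin.ext h.symm)
      rw [if_neg hne, if_neg hne']
      by_cases h1 : l.val + 1 = m.val
      · rw [if_pos (Or.inl h1), if_pos h1.symm, if_neg (by omega)]; simp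
      · rw [if_neg (fun h : (m : ℕ) = l + 1 => h1 h.symm)]
        by_cases h2 : m.val + 1 = l.val
        · rw [if_pos (Or.inr h2), if_pos h2]; simp
        · rw [if_neg (by tauto), if_neg h2]; simp
  rw [Finset.sum_congr rfl fun m _ => e m, Finset.sum_sub_distrib, Finset.sum_sub_distrib,
    Fin.sum_univ_eq_sum_range (fun m => if m = (l : ℕ) then 2 * X (m + 1) else 0),
    Fin.sum_univ_eq_sum_range (fun m => if m = (l : ℕ) + 1 then X (m + 1) else 0),
    Fin.sum_univ_eq_sum_range (fun m => if m + 1 = (l : ℕ) then X (m + 1) else 0),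
    Finset.sum_ite_eq', Finset.sum_ite_eq', if_pos (Finset.mem_range.mpr hl)]
  have h1 : (if (l : ℕ) + 1 ∈ Finset.range n then X (l + 1 + 1) else 0) = X (l + 2) := by
    split_ifs with h
    · rfl
    · rw [Finset.mem_range] at h
      rw [show (l : ℕ) + 2 = n + 1 by omega, hn]
  have h2 : ∑ m ∈ Finset.range n, (if m + 1 = (l : ℕ) then X (m + 1) else 0) = X l := by
    rcases Nat.eq_zero_or_pos (l : ℕ) with h | h
    · rw [h, h0]
      exact Finset.sum_eq_zero fun m _ => if_neg (by omega)
    · rw [Finset.sum_eq_single ((l : ℕ) - 1)]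
      · rw [if_pos (by omega), Nat.sub_add_cancel h]
      · exact fun m _ hm => if_neg (by omega)
      · exact fun hm => absurd (Finset.mem_range.mpr (by omega)) hm
  rw [h1, h2]
  ring

theorem cartan_mulVec_centredSum {n : ℕ} (a : ℕ → ℚ) :
    cartan (n + 1) *ᵥ (fun l : Fin n => centredSum n a (l + 1)) =
      fun l : Fin n => a l - a (l + 1) := by
  rw [cartan_mulVec _ (centredSum_zero n a) (centredSum_last n a)]
  funext l
  rw [centredSum_succ n a (l + 1), centredSum_succ n a l]
  ring

theorem isUnit_cartan (n : ℕ) : IsUnit (cartan (n + 1)) := by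
  rw [← Matrix.mulVec_surjective_iff_isUnit]
  intro y
  let y' : ℕ → ℚ := fun k => if h : k < n then y ⟨k, h⟩ else 0
  -- Any vector `y` is the difference vector of its negated partial sums, which gives surjectivity.
  refine ⟨_, (cartan_mulVec_centredSum fun k => -∑ i ∈ Finset.range k, y' i).trans ?_⟩
  funext l
  have hl : (l : ℕ) < n := l.isLt
  rw [Finset.sum_range_succ]
  simp only [y', dif_pos hl]
  change _ - -(_ + y l) = y l
  ring

theorem inv_cartan_mulVec {n : ℕ} (a : ℕ → ℚ) :
    (cartan (n + 1))⁻¹ *ᵥ (fun l : Fin n => a l - a (l + 1)) =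
      fun l : Fin n => centredSum n a (l + 1) := by
  have h := congrArg ((cartan (n + 1))⁻¹ *ᵥ ·) (cartan_mulVec_centredSum (n := n) a)
  simp only [Matrix.mulVec_mulVec] at h
  rw [Matrix.nonsing_inv_mul _ ((Matrix.isUnit_iff_isUnit_det _).mp (isUnit_cartan n)),
    Matrix.one_mulVec] at h
  exact h.symm

theorem firstEntry_eq {n : ℕ} {η : Fin n → ℕ} {a : ℕ → ℚ}
    (h : ∀ l : Fin n, a l - a (l + 1) = η l) :
    firstEntry (N := n + 1) η = a 0 - (∑ i ∈ Finset.range (n + 1), a i) / (n + 1) := by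
  have hη : ratVec (N := n + 1) η = fun l : Fin n => a l - a (l + 1) := funext fun l => (h l).symm
  rw [firstEntry, hη, inv_cartan_mulVec]
  have h1 := centredSum_succ n a 0
  rw [centredSum_zero, zero_add, zero_add] at h1
  rw [← h1]
  change ∑ l : Fin n, (if (l : ℕ) + 1 = 1 then (1 : ℚ) else 0) * centredSum n a (l + 1) = _
  cases n with
  | zero => simpa using (centredSum_last 0 a).symm
  | succ n => rw [Fin.sum_univ_succ]; simp

theorem quadForm_eq {n : ℕ} {η : Fin n → ℕ} {a : ℕ → ℚ}
    (h : ∀ l : Fin n, a l - a (l + 1) = η l) :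
    quadForm (N := n + 1) η =
      ∑ i ∈ Finset.range (n + 1), a i ^ 2 - (∑ i ∈ Finset.range (n + 1), a i) ^ 2 / (n + 1) := by
  have hη : ratVec (N := n + 1) η = fun l : Fin n => a l - a (l + 1) := funext fun l => (h l).symm
  rw [quadForm, hη, inv_cartan_mulVec]
  change ∑ l : Fin n, (a l - a (l + 1)) * centredSum n a (l + 1) = _
  rw [Fin.sum_univ_eq_sum_range (fun l => (a l - a (l + 1)) * centredSum n a (l + 1))]
  set c := (∑ i ∈ Finset.range (n + 1), a i) / ((n : ℚ) + 1) with hc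
  -- Summation by parts, using that consecutive centred sums differ by `a k - c`.
  have key : ∀ k, ∑ l ∈ Finset.range k, (a l - a (l + 1)) * centredSum n a (l + 1) =
      ∑ i ∈ Finset.range k, a i * (a i - c) - a k * centredSum n a k := by
    intro k
    induction k with
    | zero => simp [centredSum_zero]
    | succ k ih =>
      rw [Finset.sum_range_succ, ih, Finset.sum_range_succ _ k, centredSum_succ, ← hc]
      ring
  have h1 := centredSum_succ n a n
  rw [centredSum_last, ← hc] at h1
  have h2 : ∑ i ∈ Finset.range (n + 1), a i * (a i - c) =
      ∑ i ∈ Finset.range (n + 1), a i ^ 2 - (∑ i ∈ Finset.range (n + 1), a i) * c := by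
    rw [Finset.sum_mul, ← Finset.sum_sub_distrib]
    exact Finset.sum_congr rfl fun i _ => by ring
  rw [key, show (∑ i ∈ Finset.range (n + 1), a i) ^ 2 / ((n : ℚ) + 1) =
    (∑ i ∈ Finset.range (n + 1), a i) * c by rw [hc]; ring, ← h2, Finset.sum_range_succ]
  linear_combination a n * h1

/-! ### Chains as pairs of a top entry and a difference vector -/

/-- The decreasing sequence with first entry `r` and successive differences `η`. -/
def chainOf {n : ℕ} (r : ℤ) (η : Fin n → ℕ) (k : ℕ) : ℤ :=
  r - ∑ l ∈ Finset.range k, if h : l < n then (η ⟨l, h⟩ : ℤ) else 0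

theorem chainOf_zero {n : ℕ} (r : ℤ) (η : Fin n → ℕ) : chainOf r η 0 = r := by
  simp [chainOf]

theorem chainOf_sub {n : ℕ} (r : ℤ) (η : Fin n → ℕ) (l : Fin n) :
    chainOf r η l - chainOf r η (l + 1) = η l := by
  simp [chainOf, Finset.sum_range_succ]

/-- The chain with top `r` and differences `η`, as a point of `ℤ × ℤ ^ n`. -/
def chainMap {n : ℕ} (p : ℤ × (Fin n → ℕ)) : ℤ × (Fin n → ℤ) :=
  (p.1, fun i => chainOf p.1 p.2 (i + 1))

theorem cons_chainMap {n : ℕ} (p : ℤ × (Fin n → ℕ)) (k : Fin (n + 1)) :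
    (Fin.cons p.1 (chainMap p).2 : Fin (n + 1) → ℤ) k = chainOf p.1 p.2 k := by
  refine Fin.cases ?_ (fun i => ?_) k
  · simp [chainOf_zero]
  · simp [chainMap]

theorem chainMap_injective {n : ℕ} : Function.Injective (chainMap (n := n)) := by
  intro p p' h
  have h1 : p.1 = p'.1 := congrArg (fun x : ℤ × (Fin n → ℤ) => x.1) h
  have h2 : ∀ k : Fin (n + 1), chainOf p.1 p.2 k = chainOf p'.1 p'.2 k := fun k => by
    rw [← cons_chainMap, ← cons_chainMap, h, h1]
  refine Prod.ext h1 (funext fun l => ?_)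
  have h3 := h2 l.castSucc
  have h4 := h2 l.succ
  simp only [Fin.val_castSucc, Fin.val_succ] at h3 h4
  have h5 := chainOf_sub p.1 p.2 l
  rw [h3, h4, chainOf_sub] at h5
  exact_mod_cast h5.symm

theorem chainTerm_eq_zero_of_notMem_range {n : ℕ} (q : ℂ) {p : ℤ × (Fin n → ℤ)}
    (hp : p ∉ Set.range (chainMap (n := n))) : chainTerm q p.1 p.2 = 0 := by
  by_contra hne
  refine hp ?_
  have hd : ∀ i : Fin n, 0 ≤ (Fin.cons p.1 p.2 : Fin (n + 1) → ℤ) i.castSucc - p.2 i := by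
    intro i
    by_contra hlt
    refine hne (Finset.prod_eq_zero (Finset.mem_univ i) ?_)
    rw [qInv_of_neg q (not_le.mp hlt), mul_zero]
  let η : Fin n → ℕ := fun i => ((Fin.cons p.1 p.2 : Fin (n + 1) → ℤ) i.castSucc - p.2 i).toNat
  have hη : ∀ k : ℕ, ∀ hk : k < n + 1,
      chainOf p.1 η k = (Fin.cons p.1 p.2 : Fin (n + 1) → ℤ) ⟨k, hk⟩ := by
    intro k
    induction k with
    | zero => intro _; rw [chainOf_zero]; rfl
    | succ k ih =>
      intro hk
      have h1 := chainOf_sub p.1 η ⟨k, by omega⟩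
      have h2 := Int.toNat_of_nonneg (hd ⟨k, by omega⟩)
      have h3 := ih (by omega)
      have h4 : (Fin.cons p.1 p.2 : Fin (n + 1) → ℤ) ⟨k + 1, hk⟩ = p.2 ⟨k, by omega⟩ := rfl
      simp only [Fin.castSucc_mk] at h2
      rw [h4]
      simp only [η, Fin.castSucc_mk] at h1 h3 ⊢
      linarith
  refine ⟨(p.1, η), Prod.ext rfl (funext fun i => ?_)⟩
  exact hη (i + 1) (by omega)

theorem sum_chainMap {n : ℕ} (p : ℤ × (Fin n → ℕ)) :
    p.1 + ∑ i, (chainMap p).2 i = ∑ k ∈ Finset.range (n + 1), chainOf p.1 p.2 k := by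
  rw [Finset.sum_range_succ', chainOf_zero, add_comm]
  simp only [chainMap]
  rw [Fin.sum_univ_eq_sum_range (fun i => chainOf p.1 p.2 (i + 1))]

theorem firstEntry_eq_sub {n : ℕ} (r : ℤ) (η : Fin n → ℕ) : firstEntry (N := n + 1) η =
    r - ((∑ k ∈ Finset.range (n + 1), chainOf r η k : ℤ) : ℚ) / (n + 1) := by
  rw [firstEntry_eq (a := fun k => (chainOf r η k : ℚ))
    fun l => by exact_mod_cast chainOf_sub r η l, chainOf_zero]
  push_cast
  rfl

theorem quadForm_eq_sub {n : ℕ} (r : ℤ) (η : Fin n → ℕ) : quadForm (N := n + 1) η =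
    ((∑ k ∈ Finset.range (n + 1), chainOf r η k ^ 2 : ℤ) : ℚ) -
      ((∑ k ∈ Finset.range (n + 1), chainOf r η k : ℤ) : ℚ) ^ 2 / (n + 1) := by
  rw [quadForm_eq (a := fun k => (chainOf r η k : ℚ))
    fun l => by exact_mod_cast chainOf_sub r η l]
  push_cast
  rfl

theorem neg_sum_chainOf_admissible {n : ℕ} (r : ℤ) (η : Fin n → ℕ) :
    η ∈ Admissible (n + 1) (-∑ k ∈ Finset.range (n + 1), chainOf r η k) := by
  refine ⟨-r, ?_⟩
  rw [firstEntry_eq_sub r η]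
  push_cast
  ring

/-- Chains, given by their top and their differences, sorted by the negative of their sum. -/
def chainSigma {n : ℕ} (p : ℤ × (Fin n → ℕ)) : Σ j : ℤ, Admissible (n + 1) j :=
  ⟨_, p.2, neg_sum_chainOf_admissible p.1 p.2⟩

/-- Because `(C⁻¹η)_1 = r - s/(n+1)` and `j = -s`, the integer `m` witnessing admissibility is `-r`:
the pair `(j, η)` determines `r`, and any admissible pair comes from `r = -m`. -/
theorem chainSigma_bijective {n : ℕ} : Function.Bijective (chainSigma (n := n)) := by
  have hN : (n : ℚ) + 1 ≠ 0 := by positivity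
  constructor
  · rintro ⟨r, η⟩ ⟨r', η'⟩ h
    have h1 : (-∑ k ∈ Finset.range (n + 1), chainOf r η k) =
      -∑ k ∈ Finset.range (n + 1), chainOf r' η' k := congrArg Sigma.fst h
    have h2 : η = η' := congrArg (fun x : Σ j : ℤ, Admissible (n + 1) j => x.2.1) h
    subst h2
    have h3 := firstEntry_eq_sub r η
    rw [firstEntry_eq_sub r' η, neg_inj.mp h1] at h3
    have h4 : (r : ℚ) = r' := by linarith
    rw [Prod.mk.injEq]
    exact ⟨by exact_mod_cast h4, rfl⟩
  · rintro ⟨j, η, m, hm⟩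
    refine ⟨(-m, η), ?_⟩
    have h1 := firstEntry_eq_sub (-m) η
    have h2 : -∑ k ∈ Finset.range (n + 1), chainOf (-m) η k = j := by
      rw [h1] at hm
      push_cast at hm
      field_simp at hm
      have h3 : ((-∑ k ∈ Finset.range (n + 1), chainOf (-m) η k : ℤ) : ℚ) = j := by
        push_cast
        linarith
      exact_mod_cast h3
    subst h2
    rfl

/-! ### Matching exponents and summing -/

theorem qPow_intCast {q w : ℂ} (hw : Complex.exp w = q) (k : ℤ) : qPow w k = q ^ k := by
  rw [qPow, ← hw, ← Complex.exp_int_mul]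
  push_cast
  rfl

theorem qPow_add (w : ℂ) (s s' : ℚ) : qPow w (s + s') = qPow w s * qPow w s' := by
  rw [qPow, qPow, qPow, ← Complex.exp_add]
  push_cast
  ring_nf

theorem qPow_sum {ι : Type*} (w : ℂ) (s : Finset ι) (f : ι → ℚ) :
    qPow w (∑ i ∈ s, f i) = ∏ i ∈ s, qPow w (f i) := by
  simp only [qPow]
  rw [← Complex.exp_sum]
  push_cast
  rw [Finset.sum_mul]

theorem chainTerm_chainMap {n : ℕ} {q w : ℂ} (hw : Complex.exp w = q) (p : ℤ × (Fin n → ℕ)) :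
    q ^ (p.1 ^ 2) * chainTerm q p.1 (chainMap p).2 =
      qPow w ((∑ k ∈ Finset.range (n + 1), chainOf p.1 p.2 k ^ 2 : ℤ) : ℚ) /
        ∏ i, qPoch q q (p.2 i) := by
  have h1 : chainTerm q p.1 (chainMap p).2 =
      ∏ i : Fin n, q ^ (chainOf p.1 p.2 (i + 1) ^ 2) * (qPoch q q (p.2 i))⁻¹ := by
    refine Finset.prod_congr rfl fun i _ => ?_
    rw [cons_chainMap, Fin.val_castSucc]
    simp only [chainMap]
    rw [chainOf_sub, qInv_natCast]
  rw [h1, Finset.prod_mul_distrib, Finset.prod_inv_distrib, div_eq_mul_inv, ← mul_assoc]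
  congr 1
  push_cast
  rw [qPow_sum, Finset.prod_range_succ', chainOf_zero, mul_comm,
    Fin.prod_univ_eq_prod_range (fun i => q ^ (chainOf p.1 p.2 (i + 1) ^ 2)) n]
  simp only [← Int.cast_pow, qPow_intCast hw]

/-- The factor of `innerTerm` in `outerTerm`. -/
noncomputable def outerFactor (N : ℕ) (w : ℂ) (j : ℤ) : ℂ :=
  (-1 : ℂ) ^ j * qPow w (((1 + 2 / (N : ℚ)) * (j : ℚ) + 1) * (j : ℚ) / 2)

theorem outerFactor_ne_zero (N : ℕ) (w : ℂ) (j : ℤ) : outerFactor N w j ≠ 0 :=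
  mul_ne_zero (zpow_ne_zero _ (by norm_num)) (Complex.exp_ne_zero _)

/-- At `j = -s` the outer exponent is `s(s-1)/2 + s²/(n+1)`, and the last term cancels the one
subtracted in the quadratic form. Only integral powers of `q` remain, so the choice of logarithm
drops out. -/
theorem outerFactor_mul_innerTerm {n : ℕ} {q w : ℂ} (hw : Complex.exp w = q)
    (p : ℤ × (Fin n → ℕ)) :
    outerFactor (n + 1) w (chainSigma p).1 * innerTerm (N := n + 1) q w (chainSigma p).2.1 =
      (-1 : ℂ) ^ (p.1 + ∑ i, (chainMap p).2 i) *
      q ^ ((p.1 + ∑ i, (chainMap p).2 i) * (p.1 + ∑ i, (chainMap p).2 i - 1) / 2) *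
      (q ^ (p.1 ^ 2) * chainTerm q p.1 (chainMap p).2) := by
  rw [sum_chainMap, chainTerm_chainMap hw]
  simp only [chainSigma, outerFactor, innerTerm]
  rw [quadForm_eq_sub p.1 p.2]
  set s := ∑ k ∈ Finset.range (n + 1), chainOf p.1 p.2 k
  have hsign : (-1 : ℂ) ^ (-s) = (-1) ^ s := by
    rw [zpow_neg, ← inv_zpow, inv_neg, inv_one]
  obtain ⟨m, hm⟩ : ∃ m, s * (s - 1) = 2 * m := by
    obtain ⟨m, hm⟩ := Int.even_mul_pred_self s
    exact ⟨m, by rw [hm]; ring⟩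
  have hm' : (s : ℚ) * (s - 1) = 2 * m := by exact_mod_cast hm
  rw [hsign, hm, Int.mul_ediv_cancel_left _ two_ne_zero, ← qPow_intCast hw m, mul_assoc, mul_assoc]
  congr 1
  rw [← mul_div_assoc, ← mul_div_assoc, ← qPow_add, ← qPow_add]
  congr 2
  have hN : (n : ℚ) + 1 ≠ 0 := by positivity
  push_cast
  field_simp
  linear_combination ((n : ℚ) + 1) * hm'

theorem hasSum_sigma {n : ℕ} {q w : ℂ} (hq : ‖q‖ < 1) (hw : Complex.exp w = q) :
    HasSum (fun x : Σ j : ℤ, Admissible (n + 1) j =>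
      outerFactor (n + 1) w x.1 * innerTerm q w (x.2 : Fin (n + 1 - 1) → ℕ)) (qPochInf q q) := by
  have ht : ‖q‖ = Real.exp (-(-w.re)) := by rw [← hw, Complex.norm_exp, neg_neg]
  have ht0 : 0 < -w.re := by
    rw [ht, Real.exp_lt_one_iff] at hq
    linarith
  have h := (chainMap_injective (n := n)).hasSum_iff (fun p hp => by
    rw [chainTerm_eq_zero_of_notMem_range q hp, mul_zero, mul_zero]) |>.mpr
      (hasSum_chain ht ht0 n)
  rw [← (Equiv.ofBijective _ (chainSigma_bijective (n := n))).hasSum_iff]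
  convert h using 1
  funext p
  exact outerFactor_mul_innerTerm hw p

/-- Each fibre of an absolutely convergent family is summable, and the outer factor, being nonzero,
can be divided out. -/
theorem summable_innerTerm {n : ℕ} {q w : ℂ} (hq : ‖q‖ < 1) (hw : Complex.exp w = q) (j : ℤ) :
    Summable (fun η : Admissible (n + 1) j => innerTerm q w (η : Fin (n + 1 - 1) → ℕ)) :=
  (summable_mul_left_iff (outerFactor_ne_zero (n + 1) w j)).mp
    ((hasSum_sigma hq hw).summable.sigma_factor j)

theorem hasSum_outerTerm {n : ℕ} {q w : ℂ} (hq : ‖q‖ < 1) (hw : Complex.exp w = q) :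
    HasSum (outerTerm (n + 1) q w) (qPochInf q q) := by
  have h := (hasSum_sigma (n := n) hq hw).sigma fun j =>
    (summable_innerTerm hq hw j).hasSum.mul_left (outerFactor (n + 1) w j)
  have e : outerTerm (n + 1) q w = fun j => outerFactor (n + 1) w j *
      ∑' η : Admissible (n + 1) j, innerTerm q w (η : Fin (n + 1 - 1) → ℕ) := by
    funext j
    rw [outerTerm, outerFactor]
  rw [e]
  exact h

end GenEuler

theorem mainTheorem4 (N : ℕ) (hN : 1 ≤ N) (q w : ℂ) (hq : ‖q‖ < 1) (hw : Complex.exp w = q) :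
    Multipliable (fun i : ℕ => 1 - q * q ^ i) ∧
    (∀ j : ℤ, Summable
      (fun η : GenEuler.Admissible N j => GenEuler.innerTerm q w (η : Fin (N - 1) → ℕ))) ∧
    Summable (GenEuler.outerTerm N q w) ∧
    1 / GenEuler.qPochInf q q * ∑' j : ℤ, GenEuler.outerTerm N q w j = 1 := by
  obtain ⟨n, rfl⟩ : ∃ n, N = n + 1 := ⟨N - 1, by omega⟩
  have hin := GenEuler.summable_innerTerm (n := n) hq hw
  have hout := GenEuler.hasSum_outerTerm (n := n) hq hw
  exact ⟨GenEuler.multipliable_one_sub_mul_pow hq q, hin, hout.summable, by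
    rw [hout.tsum_eq, one_div_mul_cancel (GenEuler.qPochInf_self_ne_zero hq)]⟩
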